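/- Let $h\ge 2$ be an integer and $f=x^h\in\mathbb C[x]$, where $x$ has degree $2/h$. The category $D^b_{\mathbb Z}(\mathcal A_f)$ is defined as follows. Formal objects are $a\{2k/h\}$ and $a\{2k/h\}[-1]$, $k\in\mathbb Z$; put $r=2k/h$, parity even for the former and $r=2k/h-1$, parity odd for the latter. For finite formal direct sums $s=\bigoplus_i s_i$, $t=\bigoplus_j t_j$ of such objects, a homomorphism $\Phi:s\to t$ of degree $q\in\mathbb Z$ is a matrix $(\Phi_{ji})$ over $\mathbb C[x]$ such that $\Phi_{ji}$ is homogeneous of degree $q+r(t_j)-r(s_i)$ (or zero), and $\Phi_{ji}=0$ unless the parities of $s_i$ and $t_j$ differ by $q$ modulo $2$. An object of $D^b_{\mathbb Z}(\mathcal A_f)$ is a pair $\alpha=(s;Q_\alpha)$ with $Q_\alpha:s\to s$ of degree $1$ and $Q_\alpha^2=f\cdot\mathrm{Id}$ (a graded matrix factorization of $f$). With the differential $d\Phi=Q_\beta\Phi-(-1)^q\Phi Q_\alpha$ on homomorphisms of degree $q$, $\mathrm{Hom}(\alpha,\beta)$ is the degree $0$ cohomology of the resulting complex, and composition is induced by the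 matrix product. This is a $\mathbb C$-linear category with finite direct sums. For $l\in\{1,\dots,h-1\}$ and $i\in\mathbb Z$ let $$M_{l,i}:=\Bigl(a\{\tfrac{2i}{h}\}\oplus a\{\tfrac{2(l+i)}{h}\}[-1];\ Q_l\Bigr),\qquad Q_l=\begin{pmatrix}0&x^{h-l}\\ x^l&0\end{pmatrix}.$$ **Lemma.** 1. An object of $D^b_{\mathbb Z}(\mathcal A_f)$ is indecomposable (nonzero and not isomorphic to a direct sum of two nonzero objects) if and only if it is isomorphic to some $M_{l,i}$ with $1\le l\le h-1$, $i\in\mathbb Z$; moreover $M_{k,i}\cong M_{l,j}$ only if $k=l$ and $i=j$. 2. For all $i\in\mathbb Z$, $\mathrm{diag}(1,x)$ is closed of degree $0$ and so defines a morphism $M_{l,i}\to M_{l+1,i}$ for $1\le l\le h-2$, and $\mathrm{diag}(x,1)$ is closed of degree $0$ and so defines a morphism $M_{l,i}\to M_{l-1,i+1}$ for $2\le l\le h-1$. 3. For all $1\le k,l\le h-1$ and $i,j\in\mathbb Z$: $\mathrm{Hom}(M_{k,i},M_{l,j})\ne0$ only if $k+2i\le l+2j$. 4. For all $1\le k,l\le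 h-1$: $\mathrm{Hom}(M_{k,0},M_{l,0})\cong\mathbb C$ as a $\mathbb C$-vector space if $k\le l$, and $\mathrm{Hom}(M_{k,0},M_{l,0})=0$ if $k>l$. -/

import Mathlib

open CategoryTheory CategoryTheory.Limits Polynomial

noncomputable section

namespace MatFac

/-- The bigraded pieces `𝒜_f^q(a,a)_±` of the `ℚ`-graded category `𝒜_f`, `f = x^h`, which has one
object `a` with endomorphisms `ℂ[x]`. The variable `x` has degree `2/h`; parity `0` is even, and
the odd part vanishes. -/
def AHom (h : ℕ) (q : ℚ) (p : ZMod 2) : Submodule ℂ ℂ[X] where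
  carrier := {g | ∀ n : ℕ, g.coeff n ≠ 0 → p = 0 ∧ (2 * n : ℚ) / h = q}
  add_mem' := by
    intro g g' hg hg' n hn
    by_cases h1 : g.coeff n = 0
    · exact hg' n fun h2 => hn (by simp [h1, h2])
    · exact hg n h1
  zero_mem' := by intro n hn; simp at hn
  smul_mem' := by
    intro c g hg n hn
    exact hg n fun h2 => hn (by simp [h2])

/-- The objects of `𝒜̄_f`: `plain k` is `a{2k/h}` and `shifted l` is `a{2l/h}[-1]`. -/
inductive BarObj : Type
  | plain (k : ℤ)
  | shifted (l : ℤ)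

/-- The homomorphisms `𝒜̄_f^q(s,t)_p` of degree `q` and parity `p`. -/
def BarHom (h : ℕ) (q : ℚ) (p : ZMod 2) : BarObj → BarObj → Submodule ℂ ℂ[X]
  | .plain k, .plain l => AHom h (q + 2 * (l - k) / h) p
  | .plain k, .shifted l => AHom h (q + 2 * (l - k) / h - 1) (p + 1)
  | .shifted k, .plain l => AHom h (q + 2 * (l - k) / h + 1) (p + 1)
  | .shifted k, .shifted l => AHom h (q + 2 * (l - k) / h) p

/-- The homomorphisms of degree `q` and parity `p` between the formal direct sums `⨁ i, s i` and
`⨁ j, t j`: matrices, with columns indexed by the source and rows by the target. -/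
def TildeHom (h : ℕ) (q : ℚ) (p : ZMod 2) {ι κ : Type} (s : ι → BarObj) (t : κ → BarObj) :
    Submodule ℂ (Matrix κ ι ℂ[X]) where
  carrier := {Φ | ∀ j i, Φ j i ∈ BarHom h q p (s i) (t j)}
  add_mem' := fun hΦ hΨ j i => Submodule.add_mem _ (hΦ j i) (hΨ j i)
  zero_mem' := fun _ _ => Submodule.zero_mem _
  smul_mem' := fun c _ hΦ j i => Submodule.smul_mem _ c (hΦ j i)

/-- A graded twisted complex over `𝒜_f`, `f = x^h` (a graded matrix factorization of `x^h`): a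
finite formal direct sum `⨁ i, obj i` of objects of `𝒜̄_f` with an odd endomorphism `Q` of
degree `1` satisfying the Maurer-Cartan equation `f • Id - Q ^ 2 = 0`. -/
structure TwZ (h : ℕ) : Type 1 where
  ι : Type
  [fintype : Fintype ι]
  [decEq : DecidableEq ι]
  obj : ι → BarObj
  Q : Matrix ι ι ℂ[X]
  Q_mem : Q ∈ TildeHom h 1 1 obj obj
  maurerCartan : (X ^ h : ℂ[X]) • (1 : Matrix ι ι ℂ[X]) - Q * Q = 0

attribute [instance] TwZ.fintype TwZ.decEq

variable {h : ℕ}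

theorem mul_mem_AHom {q q' : ℚ} {p p' : ZMod 2} {g g' : ℂ[X]} (hg : g ∈ AHom h q p)
    (hg' : g' ∈ AHom h q' p') : g * g' ∈ AHom h (q + q') (p + p') := by
  intro n hn
  rw [Polynomial.coeff_mul] at hn
  obtain ⟨⟨a, b⟩, hab, hne⟩ := Finset.exists_ne_zero_of_sum_ne_zero hn
  obtain ⟨h1, h2⟩ := hg a (left_ne_zero_of_mul hne)
  obtain ⟨h3, h4⟩ := hg' b (right_ne_zero_of_mul hne)
  refine ⟨by simp [h1, h3], ?_⟩
  have : a + b = n := by simpa using hab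
  subst this
  rw [← h2, ← h4]
  push_cast
  ring

theorem mul_mem_BarHom {q q' : ℚ} {p p' : ZMod 2} {s t u : BarObj} {g g' : ℂ[X]}
    (hg' : g' ∈ BarHom h q' p' t u) (hg : g ∈ BarHom h q p s t) :
    g' * g ∈ BarHom h (q' + q) (p' + p) s u := by
  have two : (1 : ZMod 2) + 1 = 0 := by decide
  rcases s with k | k <;> rcases t with l | l <;> rcases u with m | m <;>
    simp only [BarHom] at hg hg' ⊢ <;> convert mul_mem_AHom hg' hg using 2 <;>
    first
    | ring1
    | linear_combination -two

theorem mul_mem_TildeHom {q q' : ℚ} {p p' : ZMod 2} {ι κ μ : Type} [Fintype κ]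
    {s : ι → BarObj} {t : κ → BarObj} {u : μ → BarObj}
    {Φ : Matrix κ ι ℂ[X]} {Ψ : Matrix μ κ ℂ[X]}
    (hΨ : Ψ ∈ TildeHom h q' p' t u) (hΦ : Φ ∈ TildeHom h q p s t) :
    Ψ * Φ ∈ TildeHom h (q' + q) (p' + p) s u := by
  intro j i
  rw [Matrix.mul_apply]
  exact Submodule.sum_mem _ fun k _ => mul_mem_BarHom (hΨ j k) (hΦ k i)

theorem one_mem_TildeHom {ι : Type} [DecidableEq ι] (s : ι → BarObj) :
    (1 : Matrix ι ι ℂ[X]) ∈ TildeHom h 0 0 s s := by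
  intro j i
  by_cases hij : j = i
  · subst hij
    cases s j <;> simp only [BarHom, Matrix.one_apply_eq] <;>
    · intro n hn
      have : n = 0 := by
        by_contra h0
        exact hn (by simp [Polynomial.coeff_one, h0])
      simp [this]
  · rw [Matrix.one_apply_ne hij]
    exact Submodule.zero_mem _

/-- `Tw_ℤ^q(α,β)`: the even homomorphisms of degree `q` for `q` even and the odd ones for `q`
odd. -/
def TwHom (q : ℤ) (α β : TwZ h) : Submodule ℂ (Matrix β.ι α.ι ℂ[X]) :=
  TildeHom h q q α.obj β.obj

/-- The differential `Φ ↦ Q_β Φ - (-1)^q Φ Q_α` on homomorphisms of degree `q`. -/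
def d (q : ℤ) (α β : TwZ h) : Matrix β.ι α.ι ℂ[X] →ₗ[ℂ] Matrix β.ι α.ι ℂ[X] where
  toFun Φ := β.Q * Φ - ((q.negOnePow : ℤ) : ℂ) • (Φ * α.Q)
  map_add' Φ Ψ := by
    simp only [Matrix.mul_add, Matrix.add_mul, smul_add]
    abel
  map_smul' c Φ := by
    simp only [Matrix.mul_smul, Matrix.smul_mul, RingHom.id_apply, smul_sub]
    rw [smul_comm]

theorem TwZ.Q_mem_TwHom (α : TwZ h) : α.Q ∈ TwHom 1 α α := by
  simpa [TwHom] using α.Q_mem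

theorem TwZ.Q_mul_Q (α : TwZ h) : α.Q * α.Q = (X ^ h : ℂ[X]) • (1 : Matrix α.ι α.ι ℂ[X]) :=
  (sub_eq_zero.mp α.maurerCartan).symm

theorem mul_mem_TwHom {q q' : ℤ} {α β γ : TwZ h} {Φ : Matrix β.ι α.ι ℂ[X]}
    {Ψ : Matrix γ.ι β.ι ℂ[X]} (hΨ : Ψ ∈ TwHom q' β γ) (hΦ : Φ ∈ TwHom q α β) :
    Ψ * Φ ∈ TwHom (q' + q) α γ := by
  have := mul_mem_TildeHom hΨ hΦ
  simpa [TwHom] using this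

theorem d_mem {q : ℤ} {α β : TwZ h} {Φ : Matrix β.ι α.ι ℂ[X]} (hΦ : Φ ∈ TwHom q α β) :
    d q α β Φ ∈ TwHom (q + 1) α β := by
  refine Submodule.sub_mem _ ?_ (Submodule.smul_mem _ _ (mul_mem_TwHom hΦ α.Q_mem_TwHom))
  rw [add_comm]
  exact mul_mem_TwHom β.Q_mem_TwHom hΦ

theorem d_d (q : ℤ) (α β : TwZ h) (Φ : Matrix β.ι α.ι ℂ[X]) :
    d (q + 1) α β (d q α β Φ) = 0 := by
  have e : (((q + 1).negOnePow : ℤ) : ℂ) = -((q.negOnePow : ℤ) : ℂ) := by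
    rw [Int.negOnePow_succ]; simp
  have e2 : ((q.negOnePow : ℤ) : ℂ) * ((q.negOnePow : ℤ) : ℂ) = 1 := by
    rcases Int.even_or_odd q with hq | hq
    · simp [Int.negOnePow_even q hq]
    · simp [Int.negOnePow_odd q hq]
  simp only [d, LinearMap.coe_mk, AddHom.coe_mk, e]
  rw [Matrix.mul_sub, Matrix.sub_mul, ← Matrix.mul_assoc, β.Q_mul_Q, Matrix.smul_mul,
    Matrix.smul_mul, Matrix.mul_assoc Φ, α.Q_mul_Q, Matrix.mul_smul, Matrix.mul_smul,
    Matrix.mul_one, Matrix.one_mul, Matrix.mul_assoc, smul_sub, smul_smul, neg_mul, e2,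
    neg_smul, neg_smul, one_smul]
  abel

/-- The closed homomorphisms of degree `q`. -/
def cocycles (q : ℤ) (α β : TwZ h) : Submodule ℂ (Matrix β.ι α.ι ℂ[X]) :=
  TwHom q α β ⊓ LinearMap.ker (d q α β)

/-- The exact homomorphisms of degree `q`, i.e. the image of `Tw_ℤ^{q-1}(α,β)`. -/
def coboundaries (q : ℤ) (α β : TwZ h) : Submodule ℂ (Matrix β.ι α.ι ℂ[X]) :=
  (TwHom (q - 1) α β).map (d (q - 1) α β)

theorem coboundaries_le_cocycles (q : ℤ) (α β : TwZ h) :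
    coboundaries q α β ≤ cocycles q α β := by
  rintro _ ⟨Φ, hΦ, rfl⟩
  have h1 := d_mem hΦ
  have h2 := d_d (q - 1) α β Φ
  rw [sub_add_cancel] at h1 h2
  exact ⟨h1, h2⟩

/-- The cohomology `H^q` of the complex `Tw_ℤ(α,β)`. -/
abbrev Cohomology (q : ℤ) (α β : TwZ h) : Type :=
  cocycles q α β ⧸ (coboundaries q α β).submoduleOf (cocycles q α β)

theorem mem_cocycles_zero {α β : TwZ h} {Φ : Matrix β.ι α.ι ℂ[X]} :
    Φ ∈ cocycles 0 α β ↔ Φ ∈ TwHom 0 α β ∧ β.Q * Φ = Φ * α.Q := by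
  simp [cocycles, d, sub_eq_zero]

theorem mem_coboundaries_zero {α β : TwZ h} {Φ : Matrix β.ι α.ι ℂ[X]} :
    Φ ∈ coboundaries 0 α β ↔ ∃ H ∈ TwHom (-1) α β, β.Q * H + H * α.Q = Φ := by
  simp [coboundaries, d, Int.negOnePow_odd (-1) (by decide)]

theorem mul_mem_cocycles {α β γ : TwZ h} {Φ : Matrix β.ι α.ι ℂ[X]} {Ψ : Matrix γ.ι β.ι ℂ[X]}
    (hΨ : Ψ ∈ cocycles 0 β γ) (hΦ : Φ ∈ cocycles 0 α β) : Ψ * Φ ∈ cocycles 0 α γ := by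
  rw [mem_cocycles_zero] at *
  refine ⟨by simpa using mul_mem_TwHom hΨ.1 hΦ.1, ?_⟩
  rw [← Matrix.mul_assoc, hΨ.2, Matrix.mul_assoc, hΦ.2, Matrix.mul_assoc]

theorem mul_mem_coboundaries_left {α β γ : TwZ h} {Φ : Matrix β.ι α.ι ℂ[X]}
    {Ψ : Matrix γ.ι β.ι ℂ[X]} (hΨ : Ψ ∈ cocycles 0 β γ) (hΦ : Φ ∈ coboundaries 0 α β) :
    Ψ * Φ ∈ coboundaries 0 α γ := by
  rw [mem_cocycles_zero] at hΨ
  rw [mem_coboundaries_zero] at *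
  obtain ⟨H, hH, rfl⟩ := hΦ
  refine ⟨Ψ * H, by simpa using mul_mem_TwHom hΨ.1 hH, ?_⟩
  rw [Matrix.mul_add, ← Matrix.mul_assoc, hΨ.2, Matrix.mul_assoc, Matrix.mul_assoc]

theorem mul_mem_coboundaries_right {α β γ : TwZ h} {Φ : Matrix β.ι α.ι ℂ[X]}
    {Ψ : Matrix γ.ι β.ι ℂ[X]} (hΨ : Ψ ∈ coboundaries 0 β γ) (hΦ : Φ ∈ cocycles 0 α β) :
    Ψ * Φ ∈ coboundaries 0 α γ := by
  rw [mem_cocycles_zero] at hΦ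
  rw [mem_coboundaries_zero] at *
  obtain ⟨H, hH, rfl⟩ := hΨ
  refine ⟨H * Φ, by simpa using mul_mem_TwHom hH hΦ.1, ?_⟩
  rw [Matrix.add_mul, Matrix.mul_assoc, Matrix.mul_assoc, Matrix.mul_assoc, hΦ.2]

theorem one_mem_cocycles (α : TwZ h) : (1 : Matrix α.ι α.ι ℂ[X]) ∈ cocycles 0 α α := by
  rw [mem_cocycles_zero]
  exact ⟨by simpa [TwHom] using one_mem_TildeHom α.obj, by simp⟩

/-- The objects of `D^b_ℤ(𝒜_f)`, `f = x^h`: the graded twisted complexes. -/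
abbrev DbZ (h : ℕ) : Type 1 := TwZ h

/-- Two closed homomorphisms of degree `0` represent the same class. -/
theorem mk_eq_mk {α β : TwZ h} {Φ Ψ : cocycles 0 α β} :
    (Submodule.Quotient.mk Φ : Cohomology 0 α β) = Submodule.Quotient.mk Ψ ↔
      (Φ : Matrix β.ι α.ι ℂ[X]) - Ψ ∈ coboundaries 0 α β := by
  rw [Submodule.Quotient.eq]
  rfl

/-- Composition of classes, induced by the matrix product. -/
def compClass {α β γ : TwZ h} (φ : Cohomology 0 α β) (ψ : Cohomology 0 β γ) :
    Cohomology 0 α γ :=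
  Quotient.liftOn₂' φ ψ
    (fun Φ Ψ => Submodule.Quotient.mk ⟨Ψ.1 * Φ.1, mul_mem_cocycles Ψ.2 Φ.2⟩) (by
      intro Φ Ψ Φ' Ψ' hΦ hΨ
      have h1 := mk_eq_mk.mp (Quotient.sound hΦ)
      have h2 := mk_eq_mk.mp (Quotient.sound hΨ)
      refine mk_eq_mk.mpr ?_
      have : Ψ.1 * Φ.1 - Ψ'.1 * Φ'.1 = (Ψ.1 - Ψ'.1) * Φ.1 + Ψ'.1 * (Φ.1 - Φ'.1) := by
        rw [Matrix.sub_mul, Matrix.mul_sub]; abel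
      simp only [this]
      exact Submodule.add_mem _ (mul_mem_coboundaries_right h2 Φ.2)
        (mul_mem_coboundaries_left Ψ'.2 h1))

/-- The category `D^b_ℤ(𝒜_f)`, `f = x^h`: the degree `0` cohomology category of `Tw_ℤ(𝒜_f)`. -/
instance : Category (DbZ h) where
  Hom α β := Cohomology 0 α β
  id α := Submodule.Quotient.mk ⟨1, one_mem_cocycles α⟩
  comp φ ψ := compClass φ ψ
  id_comp := by
    rintro α β ⟨Φ⟩
    exact congrArg Submodule.Quotient.mk (Subtype.ext (Matrix.mul_one Φ.1))
  comp_id := by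
    rintro α β ⟨Φ⟩
    exact congrArg Submodule.Quotient.mk (Subtype.ext (Matrix.one_mul Φ.1))
  assoc := by
    rintro α β γ δ ⟨Φ⟩ ⟨Ψ⟩ ⟨Θ⟩
    exact congrArg Submodule.Quotient.mk (Subtype.ext (Matrix.mul_assoc Θ.1 Ψ.1 Φ.1).symm)

instance : Preadditive (DbZ h) where
  homGroup α β := inferInstanceAs (AddCommGroup (Cohomology 0 α β))
  add_comp := by
    rintro α β γ ⟨Φ⟩ ⟨Φ'⟩ ⟨Ψ⟩
    exact congrArg Submodule.Quotient.mk (Subtype.ext (Matrix.mul_add Ψ.1 Φ.1 Φ'.1))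
  comp_add := by
    rintro α β γ ⟨Φ⟩ ⟨Ψ⟩ ⟨Ψ'⟩
    exact congrArg Submodule.Quotient.mk (Subtype.ext (Matrix.add_mul Ψ.1 Ψ'.1 Φ.1))

instance : Linear ℂ (DbZ h) where
  homModule α β := inferInstanceAs (Module ℂ (Cohomology 0 α β))
  smul_comp := by
    rintro α β γ c ⟨Φ⟩ ⟨Ψ⟩
    exact congrArg Submodule.Quotient.mk (Subtype.ext (Matrix.mul_smul Ψ.1 c Φ.1))
  comp_smul := by
    rintro α β γ ⟨Φ⟩ c ⟨Ψ⟩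
    exact congrArg Submodule.Quotient.mk (Subtype.ext (Matrix.smul_mul c Ψ.1 Φ.1))

/-- The morphism of `D^b_ℤ(𝒜_f)` represented by a closed homomorphism of degree `0`. -/
def toHom {α β : DbZ h} (Φ : Matrix β.ι α.ι ℂ[X]) (hΦ : Φ ∈ cocycles 0 α β) : α ⟶ β :=
  (Submodule.Quotient.mk ⟨Φ, hΦ⟩ : Cohomology 0 α β)

theorem toHom_comp {α β γ : DbZ h} (Φ : Matrix β.ι α.ι ℂ[X]) (hΦ : Φ ∈ cocycles 0 α β)
    (Ψ : Matrix γ.ι β.ι ℂ[X]) (hΨ : Ψ ∈ cocycles 0 β γ) :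
    toHom Φ hΦ ≫ toHom Ψ hΨ = toHom (Ψ * Φ) (mul_mem_cocycles hΨ hΦ) := rfl

theorem toHom_add {α β : DbZ h} (Φ Ψ : Matrix β.ι α.ι ℂ[X]) (hΦ : Φ ∈ cocycles 0 α β)
    (hΨ : Ψ ∈ cocycles 0 α β) :
    toHom Φ hΦ + toHom Ψ hΨ = toHom (Φ + Ψ) (Submodule.add_mem _ hΦ hΨ) := rfl

theorem toHom_one (α : DbZ h) : toHom 1 (one_mem_cocycles α) = 𝟙 α := rfl

theorem toHom_zero (α β : DbZ h) :
    toHom (0 : Matrix β.ι α.ι ℂ[X]) (Submodule.zero_mem _) = (0 : α ⟶ β) := rfl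

theorem toHom_congr {α β : DbZ h} {Φ Ψ : Matrix β.ι α.ι ℂ[X]} (e : Φ = Ψ)
    (hΦ : Φ ∈ cocycles 0 α β) : toHom Φ hΦ = toHom Ψ (e ▸ hΦ) := by
  subst e; rfl

/-- The direct sum of two graded twisted complexes. -/
@[reducible] def dirSum (α β : DbZ h) : DbZ h where
  ι := α.ι ⊕ β.ι
  obj := Sum.elim α.obj β.obj
  Q := Matrix.fromBlocks α.Q 0 0 β.Q
  Q_mem := by
    rintro (j | j) (i | i)
    · exact α.Q_mem j i
    · exact Submodule.zero_mem _
    · exact Submodule.zero_mem _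
    · exact β.Q_mem j i
  maurerCartan := by
    rw [Matrix.fromBlocks_multiply, α.Q_mul_Q, β.Q_mul_Q, ← Matrix.fromBlocks_one,
      Matrix.fromBlocks_smul]
    simp

theorem inl_mem (α β : DbZ h) :
    (Matrix.fromRows 1 0 : Matrix (α.ι ⊕ β.ι) α.ι ℂ[X]) ∈ cocycles 0 α (dirSum α β) := by
  rw [mem_cocycles_zero]
  constructor
  · rintro (j | j) i
    · exact (mem_cocycles_zero.mp (one_mem_cocycles α)).1 j i
    · exact Submodule.zero_mem _
  · change Matrix.fromBlocks α.Q 0 0 β.Q * Matrix.fromRows 1 0 = Matrix.fromRows 1 0 * α.Q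
    simp [Matrix.fromBlocks_mul_fromRows, Matrix.fromRows_mul]

theorem inr_mem (α β : DbZ h) :
    (Matrix.fromRows 0 1 : Matrix (α.ι ⊕ β.ι) β.ι ℂ[X]) ∈ cocycles 0 β (dirSum α β) := by
  rw [mem_cocycles_zero]
  constructor
  · rintro (j | j) i
    · exact Submodule.zero_mem _
    · exact (mem_cocycles_zero.mp (one_mem_cocycles β)).1 j i
  · change Matrix.fromBlocks α.Q 0 0 β.Q * Matrix.fromRows 0 1 = Matrix.fromRows 0 1 * β.Q
    simp [Matrix.fromBlocks_mul_fromRows, Matrix.fromRows_mul]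

theorem fst_mem (α β : DbZ h) :
    (Matrix.fromCols 1 0 : Matrix α.ι (α.ι ⊕ β.ι) ℂ[X]) ∈ cocycles 0 (dirSum α β) α := by
  rw [mem_cocycles_zero]
  constructor
  · rintro j (i | i)
    · exact (mem_cocycles_zero.mp (one_mem_cocycles α)).1 j i
    · exact Submodule.zero_mem _
  · change α.Q * Matrix.fromCols 1 0 = Matrix.fromCols 1 0 * Matrix.fromBlocks α.Q 0 0 β.Q
    simp [Matrix.fromCols_mul_fromBlocks, Matrix.mul_fromCols]

theorem snd_mem (α β : DbZ h) :
    (Matrix.fromCols 0 1 : Matrix β.ι (α.ι ⊕ β.ι) ℂ[X]) ∈ cocycles 0 (dirSum α β) β := by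
  rw [mem_cocycles_zero]
  constructor
  · rintro j (i | i)
    · exact Submodule.zero_mem _
    · exact (mem_cocycles_zero.mp (one_mem_cocycles β)).1 j i
  · change β.Q * Matrix.fromCols 0 1 = Matrix.fromCols 0 1 * Matrix.fromBlocks α.Q 0 0 β.Q
    simp [Matrix.fromCols_mul_fromBlocks, Matrix.mul_fromCols]

/-- The direct sum as a biproduct diagram. -/
@[reducible] def dirSumBicone (α β : DbZ h) : BinaryBicone α β where
  pt := dirSum α β
  fst := toHom _ (fst_mem α β)
  snd := toHom _ (snd_mem α β)
  inl := toHom _ (inl_mem α β)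
  inr := toHom _ (inr_mem α β)
  inl_fst := by
    rw [toHom_comp, ← toHom_one]
    exact toHom_congr (by simp [Matrix.fromCols_mul_fromRows]) _
  inl_snd := by
    rw [toHom_comp, ← toHom_zero]
    exact toHom_congr (by simp [Matrix.fromCols_mul_fromRows]) _
  inr_fst := by
    rw [toHom_comp, ← toHom_zero]
    exact toHom_congr (by simp [Matrix.fromCols_mul_fromRows]) _
  inr_snd := by
    rw [toHom_comp, ← toHom_one]
    exact toHom_congr (by simp [Matrix.fromCols_mul_fromRows]) _

instance : HasBinaryBiproducts (DbZ h) where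
  has_binary_biproduct α β := hasBinaryBiproduct_of_total (dirSumBicone α β) (by
    change toHom _ (fst_mem α β) ≫ toHom _ (inl_mem α β) +
      toHom _ (snd_mem α β) ≫ toHom _ (inr_mem α β) = 𝟙 (dirSum α β)
    rw [toHom_comp, toHom_comp, toHom_add, ← toHom_one]
    refine toHom_congr ?_ _
    change _ = (1 : Matrix (α.ι ⊕ β.ι) (α.ι ⊕ β.ι) ℂ[X])
    rw [Matrix.fromRows_mul_fromCols, Matrix.fromRows_mul_fromCols, Matrix.fromBlocks_add,
      ← Matrix.fromBlocks_one]
    simp)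

theorem X_pow_mem_AHom {h n : ℕ} {q : ℚ} (hq : (2 * n : ℚ) / h = q) :
    (X ^ n : ℂ[X]) ∈ AHom h q 0 := by
  intro m hm
  rw [Polynomial.coeff_X_pow] at hm
  have : m = n := by by_contra hne; simp [hne] at hm
  subst this
  exact ⟨rfl, hq⟩

/-- The object `M_{l,i} = (a{2i/h} ⊕ a{2(l+i)/h}[-1]; Q_l)`, `1 ≤ l ≤ h - 1`. -/
@[reducible] def M (h : ℕ) (l : Set.Icc 1 (h - 1)) (i : ℤ) : DbZ h where
  ι := Fin 2
  obj := ![.plain i, .shifted (l + i)]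
  Q := !![0, X ^ (h - l : ℕ); X ^ (l : ℕ), 0]
  Q_mem := by
    obtain ⟨l, h1, h2⟩ := l
    have hl : l ≤ h := by omega
    have h0 : (h : ℚ) ≠ 0 := by
      have : h ≠ 0 := by omega
      exact_mod_cast this
    have two : (1 : ZMod 2) + 1 = 0 := by decide
    intro a b
    fin_cases a <;> fin_cases b
    · exact Submodule.zero_mem _
    · simp only [BarHom, Fin.zero_eta, Fin.mk_one, Matrix.cons_val_zero, Matrix.cons_val_one,
        Matrix.of_apply, two]
      apply X_pow_mem_AHom
      push_cast [hl]
      field_simp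
      ring
    · simp only [BarHom, Fin.zero_eta, Fin.mk_one, Matrix.cons_val_zero, Matrix.cons_val_one,
        Matrix.of_apply, two]
      apply X_pow_mem_AHom
      push_cast
      field_simp
      ring
    · exact Submodule.zero_mem _
  maurerCartan := by
    obtain ⟨l, h1, h2⟩ := l
    have hl : l ≤ h := by omega
    have e1 : (X ^ (h - l) * X ^ l : ℂ[X]) = X ^ h := by rw [← pow_add]; congr 1; omega
    have e2 : (X ^ l * X ^ (h - l) : ℂ[X]) = X ^ h := by rw [← pow_add]; congr 1; omega
    rw [sub_eq_zero]
    ext1 a b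
    fin_cases a <;> fin_cases b <;> simp [e1, e2]

end MatFac

end

noncomputable section

namespace MatFac

variable {h : ℕ}

/-! The classification is graded Gaussian elimination. Homogeneous polynomials are monomials, so
among the nonzero entries of `Q` from the even to the odd part one of minimal degree divides all the
others. Its row and column can be cleared by an invertible degree `0` change of basis
(`exists_iso_cleared`). The equation `Q² = x^h` then forces the opposite entry to be the
complementary power of `x` and kills the rest of the two rows and columns, so a summand `rankTwo`
with exponent `0 ≤ m ≤ h` splits off (`exists_iso_of_cleared_of_eq_X_pow`). For `m = 0` or `m = h`
it is contractible, otherwise it is some `M`; induction on the number of formal summands finishes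
the argument.

Morphisms are found by degree count. A closed degree `0` map between two `M`s is diagonal, and
closedness makes either diagonal entry determine the other. If one of the two prescribed degrees is
negative the map vanishes (`le_of_nontrivial_hom`); the resulting inequalities give both the
vanishing statements and uniqueness. For equal shifts there are no homotopies and `Hom` is spanned
by one diagonal matrix (`nonempty_hom_M_equiv`). In particular endomorphisms of `M` are scalars, so
`M` is indecomposable. -/

/-! ### Homogeneous polynomials are monomials. -/

theorem AHom_eq_zero_of_parity {q : ℚ} {p : ZMod 2} (hp : p ≠ 0) {g : ℂ[X]}
    (hg : g ∈ AHom h q p) : g = 0 := by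
  ext n
  by_contra hn
  exact hp (hg n hn).1

theorem AHom_eq_zero_of_neg {q : ℚ} {p : ZMod 2} (hq : q < 0) {g : ℂ[X]}
    (hg : g ∈ AHom h q p) : g = 0 := by
  ext n
  by_contra hn
  have := (hg n hn).2
  have h0 : (0 : ℚ) ≤ (2 * n : ℚ) / h := by positivity
  linarith

/-- The degree `2n/h` determines `n`. This needs `h ≠ 0`: division by zero would give every monomial
degree `0`. -/
theorem AHom_eq_monomial (h0 : h ≠ 0) {n : ℕ} {q : ℚ} (hq : (2 * n : ℚ) / h = q) {p : ZMod 2}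
    {g : ℂ[X]} (hg : g ∈ AHom h q p) : g = C (g.coeff n) * X ^ n := by
  ext m
  rw [coeff_C_mul, coeff_X_pow]
  split_ifs with e
  · simp [e]
  · by_contra hm
    rw [mul_zero] at hm
    have h1 := (hg m hm).2
    rw [← hq] at h1
    have : (h : ℚ) ≠ 0 := by exact_mod_cast h0
    field_simp at h1
    exact e (by exact_mod_cast h1)

theorem exists_eq_monomial_of_mem_AHom (h0 : h ≠ 0) {q : ℚ} {p : ZMod 2} {g : ℂ[X]}
    (hg : g ∈ AHom h q p) (hne : g ≠ 0) :
    p = 0 ∧ ∃ (n : ℕ) (c : ℂ), c ≠ 0 ∧ (2 * n : ℚ) / h = q ∧ g = C c * X ^ n := by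
  have hc : g.coeff g.natDegree ≠ 0 := by simpa using hne
  obtain ⟨h1, h2⟩ := hg _ hc
  exact ⟨h1, _, _, hc, h2, AHom_eq_monomial h0 h2 hg⟩

theorem C_mem_AHom (c : ℂ) : (C c : ℂ[X]) ∈ AHom h 0 0 := by
  have := (AHom h 0 0).smul_mem c (X_pow_mem_AHom (h := h) (n := 0) (q := 0) (by simp))
  rwa [pow_zero, smul_eq_C_mul, mul_one] at this

/-- Divisibility of monomials is comparison of exponents, and the quotient is again homogeneous.
This makes the elimination coefficients homomorphisms of degree `0`. -/
theorem exists_mul_eq_of_mem_AHom (h0 : h ≠ 0) {q q' : ℚ} {p p' : ZMod 2} {g g' : ℂ[X]}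
    (hg : g ∈ AHom h q p) (hg' : g' ∈ AHom h q' p') (hne' : g' ≠ 0)
    (hdeg : g ≠ 0 → g'.natDegree ≤ g.natDegree) :
    ∃ r ∈ AHom h (q - q') 0, g = r * g' := by
  by_cases hne : g = 0
  · exact ⟨0, Submodule.zero_mem _, by simp [hne]⟩
  obtain ⟨-, n, c, hc, hn, rfl⟩ := exists_eq_monomial_of_mem_AHom h0 hg hne
  obtain ⟨-, n', c', hc', hn', rfl⟩ := exists_eq_monomial_of_mem_AHom h0 hg' hne'
  have hle := hdeg hne
  rw [natDegree_C_mul_X_pow _ _ hc, natDegree_C_mul_X_pow _ _ hc'] at hle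
  obtain ⟨m, rfl⟩ := Nat.exists_eq_add_of_le hle
  refine ⟨C (c / c') * X ^ m, ?_, ?_⟩
  · rw [← smul_eq_C_mul]
    refine Submodule.smul_mem _ _ (X_pow_mem_AHom ?_)
    rw [← hn, ← hn']
    push_cast
    ring
  · have : c = c / c' * c' := by field_simp
    conv_lhs => rw [this, C_mul]
    ring

/-! ### Rank two factorizations and the contractible ones. -/

/-- The object `(a{2i/h} ⊕ a{2(m+i)/h}[-1]; Q_m)`, `0 ≤ m ≤ h`. For `m = 0` and `m = h` it is
contractible. -/
@[reducible] def rankTwo (h0 : h ≠ 0) (m : ℕ) (hm : m ≤ h) (i : ℤ) : DbZ h where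
  ι := Fin 2
  obj := ![.plain i, .shifted (m + i)]
  Q := !![0, X ^ (h - m); X ^ m, 0]
  Q_mem := by
    have h0 : (h : ℚ) ≠ 0 := by exact_mod_cast h0
    have two : (1 : ZMod 2) + 1 = 0 := by decide
    intro a b
    fin_cases a <;> fin_cases b
    · exact Submodule.zero_mem _
    · simp only [BarHom, Fin.zero_eta, Fin.mk_one, Matrix.cons_val_zero, Matrix.cons_val_one,
        Matrix.of_apply, two]
      apply X_pow_mem_AHom
      push_cast [hm]
      field_simp
      ring
    · simp only [BarHom, Fin.zero_eta, Fin.mk_one, Matrix.cons_val_zero, Matrix.cons_val_one,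
        Matrix.of_apply, two]
      apply X_pow_mem_AHom
      push_cast
      field_simp
      ring
    · exact Submodule.zero_mem _
  maurerCartan := by
    have e1 : (X ^ (h - m) * X ^ m : ℂ[X]) = X ^ h := by rw [← pow_add]; congr 1; omega
    have e2 : (X ^ m * X ^ (h - m) : ℂ[X]) = X ^ h := by rw [← pow_add]; congr 1; omega
    rw [sub_eq_zero]
    ext1 a b
    fin_cases a <;> fin_cases b <;> simp [e1, e2]

theorem toHom_eq_zero_iff {α β : DbZ h} {Φ : Matrix β.ι α.ι ℂ[X]} (hΦ : Φ ∈ cocycles 0 α β) :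
    toHom Φ hΦ = 0 ↔ Φ ∈ coboundaries 0 α β := by
  rw [← toHom_zero]
  refine mk_eq_mk.trans ?_
  simp

theorem smul_toHom {α β : DbZ h} (c : ℂ) {Φ : Matrix β.ι α.ι ℂ[X]} (hΦ : Φ ∈ cocycles 0 α β) :
    c • toHom Φ hΦ = toHom (c • Φ) (Submodule.smul_mem _ c hΦ) := rfl

theorem exists_eq_toHom {α β : DbZ h} (f : α ⟶ β) : ∃ Φ, ∃ hΦ, f = toHom Φ hΦ := by
  obtain ⟨Φ⟩ := f
  exact ⟨Φ.1, Φ.2, rfl⟩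

theorem isZero_rankTwo (h0 : h ≠ 0) (m : ℕ) (hm : m ≤ h) (i : ℤ) (hm' : m = 0 ∨ m = h) :
    IsZero (rankTwo h0 m hm i) := by
  rw [IsZero.iff_id_eq_zero, ← toHom_one, toHom_eq_zero_iff, mem_coboundaries_zero]
  have h0' : (h : ℚ) ≠ 0 := by exact_mod_cast h0
  have one : (1 : ℂ[X]) ∈ AHom h 0 0 := by simpa using C_mem_AHom (h := h) 1
  -- One off-diagonal entry of `Q` equals `1`; the matrix unit in the opposite position is a
  -- contracting homotopy.
  rcases hm' with e | e
  · refine ⟨!![0, 1; 0, 0], ?_, ?_⟩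
    · intro a b
      fin_cases a <;> fin_cases b <;> simp [BarHom, e]
      exact one
    · ext1 a b
      fin_cases a <;> fin_cases b <;> simp [e]
  · refine ⟨!![0, 0; 1, 0], ?_, ?_⟩
    · intro a b
      fin_cases a <;> fin_cases b <;> simp [BarHom]
      convert one using 2
      · rw [e]
        field_simp
        ring
      · decide
    · ext1 a b
      fin_cases a <;> fin_cases b <;> simp [e]

/-! ### Isomorphisms given by invertible matrices. -/

/-- Mutually inverse closed homomorphisms of degree `0` give an isomorphism. -/
def isoOfMatrix {α β : DbZ h} (F : Matrix β.ι α.ι ℂ[X]) (G : Matrix α.ι β.ι ℂ[X])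
    (hF : F ∈ cocycles 0 α β) (hG : G ∈ cocycles 0 β α) (hGF : G * F = 1) (hFG : F * G = 1) :
    α ≅ β where
  hom := toHom F hF
  inv := toHom G hG
  hom_inv_id := by
    rw [toHom_comp, ← toHom_one]
    exact toHom_congr hGF _
  inv_hom_id := by
    rw [toHom_comp, ← toHom_one]
    exact toHom_congr hFG _

/-- Permutation matrices are closed of degree `0`, so relabelling the formal summands changes
nothing up to isomorphism. Used to recognize a block diagonal `Q` as a `dirSum`. -/
theorem nonempty_iso_of_equiv {α β : DbZ h} (e : β.ι ≃ α.ι)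
    (hobj : ∀ x, α.obj (e x) = β.obj x) (hQ : ∀ x y, α.Q (e x) (e y) = β.Q x y) :
    Nonempty (α ≅ β) := by
  have hQ' : β.Q = α.Q.submatrix e e := by ext1 x y; exact (hQ x y).symm
  have one := (mem_cocycles_zero.mp (one_mem_cocycles α)).1
  refine ⟨isoOfMatrix ((1 : Matrix α.ι α.ι ℂ[X]).submatrix e id)
    ((1 : Matrix α.ι α.ι ℂ[X]).submatrix id e) ?_ ?_ ?_ ?_⟩
  · refine mem_cocycles_zero.mpr ⟨fun x y => ?_, ?_⟩
    · have := one (e x) y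
      rwa [hobj] at this
    · rw [hQ', Matrix.submatrix_mul_equiv]
      ext1 x y
      simp [Matrix.mul_apply, Matrix.one_apply]
  · refine mem_cocycles_zero.mpr ⟨fun x y => ?_, ?_⟩
    · have := one x (e y)
      rwa [hobj] at this
    · rw [hQ', Matrix.submatrix_mul_equiv]
      ext1 x y
      simp [Matrix.mul_apply, Matrix.one_apply]
  · rw [Matrix.submatrix_mul_equiv]
    simp
  · ext1 x y
    simp [Matrix.mul_apply, Matrix.one_apply]

/-- Change of basis by an invertible homomorphism of degree `0`. -/
@[reducible] def conj (α : DbZ h) (P P' : Matrix α.ι α.ι ℂ[X]) (hP : P ∈ TwHom 0 α α)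
    (hP' : P' ∈ TwHom 0 α α) (hPP' : P' * P = 1) : DbZ h where
  ι := α.ι
  obj := α.obj
  Q := P * α.Q * P'
  Q_mem := by
    have := mul_mem_TwHom (mul_mem_TwHom hP α.Q_mem_TwHom) hP'
    simpa [TwHom] using this
  maurerCartan := by
    have : P * P' = 1 := mul_eq_one_comm.mp hPP'
    rw [sub_eq_zero]
    calc _ = P * ((X ^ h : ℂ[X]) • (1 : Matrix α.ι α.ι ℂ[X])) * P' := by simp [this]
      _ = P * (α.Q * (P' * P) * α.Q) * P' := by rw [hPP', Matrix.mul_one, α.Q_mul_Q]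
      _ = _ := by simp only [Matrix.mul_assoc]

/-- The change of basis is an isomorphism. -/
def conjIso (α : DbZ h) (P P' : Matrix α.ι α.ι ℂ[X]) (hP : P ∈ TwHom 0 α α)
    (hP' : P' ∈ TwHom 0 α α) (hPP' : P' * P = 1) : α ≅ conj α P P' hP hP' hPP' :=
  isoOfMatrix (β := conj α P P' hP hP' hPP') P P'
    (mem_cocycles_zero.mpr ⟨hP, by
      change P * α.Q * P' * P = P * α.Q
      rw [Matrix.mul_assoc, hPP', Matrix.mul_one]⟩)
    (mem_cocycles_zero.mpr ⟨hP', by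
      change α.Q * P' = P' * (P * α.Q * P')
      rw [← Matrix.mul_assoc, ← Matrix.mul_assoc, hPP', Matrix.one_mul]⟩)
    hPP' (mul_eq_one_comm.mp hPP')

theorem dirSumBicone_total (α β : DbZ h) :
    (dirSumBicone α β).fst ≫ (dirSumBicone α β).inl +
      (dirSumBicone α β).snd ≫ (dirSumBicone α β).inr = 𝟙 (dirSumBicone α β).pt := by
  change toHom _ (fst_mem α β) ≫ toHom _ (inl_mem α β) +
    toHom _ (snd_mem α β) ≫ toHom _ (inr_mem α β) = 𝟙 (dirSum α β)
  rw [toHom_comp, toHom_comp, toHom_add, ← toHom_one]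
  refine toHom_congr ?_ _
  change _ = (1 : Matrix (α.ι ⊕ β.ι) (α.ι ⊕ β.ι) ℂ[X])
  rw [Matrix.fromRows_mul_fromCols, Matrix.fromRows_mul_fromCols, Matrix.fromBlocks_add,
    ← Matrix.fromBlocks_one]
  simp

/-- The explicit direct sum is the biproduct. -/
def dirSumIso (α β : DbZ h) : dirSum α β ≅ α ⊞ β :=
  biprod.uniqueUpToIso α β (isBinaryBilimitOfTotal _ (dirSumBicone_total α β))

/-! ### Morphisms between the objects `M h k i`. -/

theorem ne_zero_of_mem_Icc (l : Set.Icc 1 (h - 1)) : h ≠ 0 := by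
  obtain ⟨l, h1, h2⟩ := l
  omega

/-- The exponents are those forced by degree `0`. This covers both families of maps in the main
theorem and the generator of `Hom` for equal shifts. -/
theorem diag_mem_cocycles (k l : Set.Icc 1 (h - 1)) (i j : ℤ) (a b : ℕ) (ha : (a : ℤ) = j - i)
    (hb : (b : ℤ) = l + j - k - i) :
    (!![X ^ a, 0; 0, X ^ b] : Matrix (Fin 2) (Fin 2) ℂ[X]) ∈
      cocycles 0 (M h k i) (M h l j) := by
  have hk := k.2.2
  have hl := l.2.2
  have ha' : (a : ℚ) = j - i := by exact_mod_cast ha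
  have hb' : (b : ℚ) = l + j - k - i := by exact_mod_cast hb
  refine mem_cocycles_zero.mpr ⟨?_, ?_⟩
  · intro x y
    fin_cases x <;> fin_cases y
    · simp only [BarHom, Fin.zero_eta, Matrix.cons_val_zero, Matrix.of_apply]
      apply X_pow_mem_AHom
      rw [ha']
      simp
    · exact Submodule.zero_mem _
    · exact Submodule.zero_mem _
    · simp only [BarHom, Fin.mk_one, Matrix.cons_val_one, Matrix.of_apply]
      apply X_pow_mem_AHom
      rw [hb']
      push_cast
      ring
  · ext1 x y
    fin_cases x <;> fin_cases y <;> simp [← pow_add] <;> congr 1 <;> omega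

/-- Closed homomorphisms of degree `0` between the `M h k i` are diagonal. -/
theorem cocycle_M_apply {k l : Set.Icc 1 (h - 1)} {i j : ℤ} {Φ : Matrix (Fin 2) (Fin 2) ℂ[X]}
    (hΦ : Φ ∈ cocycles 0 (M h k i) (M h l j)) :
    Φ 0 0 ∈ AHom h (2 * (j - i) / h) 0 ∧ Φ 1 1 ∈ AHom h (2 * (l + j - (k + i)) / h) 0 ∧
      Φ 0 1 = 0 ∧ Φ 1 0 = 0 ∧ X ^ (l : ℕ) * Φ 0 0 = Φ 1 1 * X ^ (k : ℕ) := by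
  obtain ⟨h1, h2⟩ := mem_cocycles_zero.mp hΦ
  refine ⟨?_, ?_, ?_, ?_, ?_⟩
  · simpa [BarHom] using h1 0 0
  · simpa [BarHom] using h1 1 1
  · exact AHom_eq_zero_of_parity (by decide) (h1 0 1)
  · exact AHom_eq_zero_of_parity (by decide) (h1 1 0)
  · simpa [Matrix.mul_apply, Fin.sum_univ_two] using congrFun (congrFun h2 1) 0

/-- Each inequality says that one diagonal entry has nonnegative degree. If either fails, that entry
is zero, and `X ^ l * Φ 0 0 = Φ 1 1 * X ^ k` kills the other one. Keeping the two inequalities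
separate, rather than only their sum, is what yields uniqueness. -/
theorem le_of_nontrivial_hom {k l : Set.Icc 1 (h - 1)} {i j : ℤ}
    (H : Nontrivial (M h k i ⟶ M h l j)) : i ≤ j ∧ (k : ℤ) + i ≤ l + j := by
  by_contra hlt
  refine not_subsingleton_iff_nontrivial.mpr H ⟨fun f g => ?_⟩
  suffices H : ∀ f : M h k i ⟶ M h l j, f = 0 by rw [H f, H g]
  intro f
  obtain ⟨Φ, hΦ, rfl⟩ := exists_eq_toHom f
  have hpos : (0 : ℚ) < h := by
    exact_mod_cast Nat.pos_of_ne_zero (ne_zero_of_mem_Icc k)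
  obtain ⟨h00, h11, h01, h10, hc⟩ := cocycle_M_apply hΦ
  have hz : Φ = 0 := by
    have key : Φ 0 0 = 0 ∧ Φ 1 1 = 0 := by
      rw [not_and_or, not_le, not_le] at hlt
      rcases hlt with hlt | hlt
      · have h0 : Φ 0 0 = 0 := by
          refine AHom_eq_zero_of_neg (div_neg_of_neg_of_pos ?_ hpos) h00
          have : (j : ℚ) < i := by exact_mod_cast hlt
          linarith
        refine ⟨h0, ?_⟩
        simpa [h0] using hc.symm
      · have h1 : Φ 1 1 = 0 := by
          refine AHom_eq_zero_of_neg (div_neg_of_neg_of_pos ?_ hpos) h11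
          have : (l + j : ℚ) < k + i := by exact_mod_cast hlt
          linarith
        refine ⟨?_, h1⟩
        simpa [h1] using hc
    ext1 x y
    fin_cases x <;> fin_cases y <;> simp [key, h01, h10]
  rw [toHom_congr hz, toHom_zero]

/-- A homotopy is off-diagonal by parity, with entries of degrees `-2k/h` and `2l/h - 2`. Both are
negative because `0 < k` and `l < h`. -/
theorem coboundaries_M_eq_bot (k l : Set.Icc 1 (h - 1)) (i : ℤ) :
    coboundaries 0 (M h k i) (M h l i) = ⊥ := by
  rw [eq_bot_iff]
  intro Φ hΦ
  obtain ⟨H, hH, rfl⟩ := mem_coboundaries_zero.mp hΦ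
  obtain ⟨hk, hk'⟩ := k.2
  obtain ⟨hl, hl'⟩ := l.2
  have hpos : (0 : ℚ) < h := by
    exact_mod_cast Nat.pos_of_ne_zero (ne_zero_of_mem_Icc k)
  have h00 : H 0 0 = 0 := AHom_eq_zero_of_parity (by decide) (hH 0 0)
  have h11 : H 1 1 = 0 := AHom_eq_zero_of_parity (by decide) (hH 1 1)
  have h01 : H 0 1 = 0 := by
    refine AHom_eq_zero_of_neg ?_ (hH 0 1)
    have : (0 : ℚ) < (k : ℕ) := by exact_mod_cast hk
    push_cast
    field_simp
    linarith
  have h10 : H 1 0 = 0 := by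
    refine AHom_eq_zero_of_neg ?_ (hH 1 0)
    have : ((l : ℕ) : ℚ) < h := by exact_mod_cast (by omega : (l : ℕ) < h)
    push_cast
    field_simp
    linarith
  have hz : H = 0 := by
    ext1 x y
    fin_cases x <;> fin_cases y <;> simp [h00, h11, h01, h10]
  simp [hz]

theorem nonempty_hom_M_equiv {k l : Set.Icc 1 (h - 1)} (hkl : k ≤ l) (i : ℤ) :
    Nonempty ((M h k i ⟶ M h l i) ≃ₗ[ℂ] ℂ) := by
  obtain ⟨b, hb⟩ := Nat.exists_eq_add_of_le (show (k : ℕ) ≤ l from hkl)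
  have h0 := ne_zero_of_mem_Icc k
  have hb' : (b : ℤ) = l + i - k - i := by rw [hb]; push_cast; ring
  let φ : M h k i ⟶ M h l i := toHom _ (diag_mem_cocycles k l i i 0 b (by simp) hb')
  let T : ℂ →ₗ[ℂ] (M h k i ⟶ M h l i) := LinearMap.toSpanSingleton ℂ _ φ
  refine ⟨(LinearEquiv.ofBijective T ⟨?_, ?_⟩).symm⟩
  · rw [injective_iff_map_eq_zero]
    intro c hc
    rw [LinearMap.toSpanSingleton_apply, smul_toHom, toHom_eq_zero_iff, coboundaries_M_eq_bot,
      Submodule.mem_bot] at hc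
    have := congrFun (congrFun hc 0) 0
    simpa using this
  · intro f
    obtain ⟨Φ, hΦ, rfl⟩ := exists_eq_toHom f
    obtain ⟨h00, -, h01, h10, hc⟩ := cocycle_M_apply hΦ
    refine ⟨(Φ 0 0).coeff 0, ?_⟩
    rw [LinearMap.toSpanSingleton_apply, smul_toHom]
    refine toHom_congr ?_ _
    have e0 : Φ 0 0 = C ((Φ 0 0).coeff 0) := by
      simpa using AHom_eq_monomial (n := 0) h0 (by simp) h00
    -- Closedness determines the second diagonal entry after cancelling `X ^ k`.
    have e1 : Φ 1 1 = C ((Φ 0 0).coeff 0) * X ^ b := by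
      refine mul_right_cancel₀ (pow_ne_zero (k : ℕ) X_ne_zero) ?_
      rw [← hc, hb, ← e0]
      ring
    ext1 x y
    fin_cases x <;> fin_cases y
    · simpa [smul_eq_C_mul] using e0.symm
    · simp [h01]
    · simp [h10]
    · simpa [smul_eq_C_mul] using e1.symm

/-! ### Uniqueness and indecomposability of the `M h k i`. -/

theorem nontrivial_end_M (k : Set.Icc 1 (h - 1)) (i : ℤ) : Nontrivial (M h k i ⟶ M h k i) :=
  (nonempty_hom_M_equiv le_rfl i).some.toEquiv.nontrivial

theorem not_isZero_M (k : Set.Icc 1 (h - 1)) (i : ℤ) : ¬ IsZero (M h k i) := fun hz =>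
  not_subsingleton_iff_nontrivial.mpr (nontrivial_end_M k i) ⟨fun _ _ => hz.eq_of_src _ _⟩

/-- Nonzero morphisms exist in both directions, so both inequalities of `le_of_nontrivial_hom`
become equalities. -/
theorem eq_of_iso_M {k l : Set.Icc 1 (h - 1)} {i j : ℤ} (e : M h k i ≅ M h l j) :
    k = l ∧ i = j := by
  have h1 := nontrivial_end_M k i
  have a : Nontrivial (M h k i ⟶ M h l j) :=
    ((Iso.refl (M h k i)).homCongr e).symm.nontrivial
  have b : Nontrivial (M h l j ⟶ M h k i) :=
    (e.homCongr (Iso.refl (M h k i))).symm.nontrivial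
  have h2 := le_of_nontrivial_hom a
  have h3 := le_of_nontrivial_hom b
  exact ⟨Subtype.ext (by omega), by omega⟩

theorem exists_eq_smul_id_M (k : Set.Icc 1 (h - 1)) (i : ℤ) (f : M h k i ⟶ M h k i) :
    ∃ c : ℂ, f = c • 𝟙 (M h k i) := by
  obtain ⟨T⟩ := nonempty_hom_M_equiv (le_refl k) i
  have h1 : T (𝟙 _) ≠ 0 := fun h0 => not_isZero_M k i
    ((IsZero.iff_id_eq_zero _).mpr (T.map_eq_zero_iff.mp h0))
  refine ⟨T f / T (𝟙 _), T.injective ?_⟩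
  rw [map_smul, smul_eq_mul, div_mul_cancel₀ _ h1]

/-- The projector onto `Y` is a scalar `c`. Restricting it to `Y` and to `Z` gives `𝟙 Y = c • 𝟙 Y`
and `0 = c • 𝟙 Z`, so one summand vanishes according to whether `c = 0`. -/
theorem indecomposable_of_end {C : Type*} [Category C] [Preadditive C] [Linear ℂ C]
    [HasBinaryBiproducts C] {A : C} (h0 : ¬ IsZero A)
    (hA : ∀ f : A ⟶ A, ∃ c : ℂ, f = c • 𝟙 A) : Indecomposable A := by
  refine ⟨h0, fun Y Z e => ?_⟩
  obtain ⟨c, hc⟩ := hA (e.hom ≫ biprod.fst ≫ biprod.inl ≫ e.inv)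
  have hY : 𝟙 Y = c • 𝟙 Y := by
    have : biprod.inl ≫ e.inv ≫ (e.hom ≫ biprod.fst ≫ biprod.inl ≫ e.inv) ≫ e.hom ≫ biprod.fst =
      𝟙 Y := by simp
    rw [hc] at this
    simpa using this.symm
  have hZ : 0 = c • 𝟙 Z := by
    have : biprod.inr ≫ e.inv ≫ (e.hom ≫ biprod.fst ≫ biprod.inl ≫ e.inv) ≫ e.hom ≫ biprod.snd =
      0 := by simp
    rw [hc] at this
    simpa using this.symm
  by_cases hc0 : c = 0
  · left
    rw [IsZero.iff_id_eq_zero, hY, hc0, zero_smul]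
  · right
    rw [IsZero.iff_id_eq_zero]
    exact (smul_eq_zero_iff_right hc0).mp hZ.symm

theorem indecomposable_of_iso_M {α : DbZ h} {k : Set.Icc 1 (h - 1)} {i : ℤ} (e : α ≅ M h k i) :
    Indecomposable α := by
  obtain ⟨h1, h2⟩ := indecomposable_of_end (not_isZero_M k i) (exists_eq_smul_id_M k i)
  exact ⟨fun hz => h1 (hz.of_iso e.symm), fun Y Z e' => h2 Y Z (e.symm ≪≫ e')⟩

/-! ### Parity of `Q` and the choice of a pivot. -/

theorem Q_plain_plain (α : TwZ h) {x y : α.ι} {k l : ℤ} (hx : α.obj x = .plain k)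
    (hy : α.obj y = .plain l) : α.Q y x = 0 := by
  have := α.Q_mem y x
  rw [hx, hy] at this
  exact AHom_eq_zero_of_parity (by decide) this

theorem Q_shifted_shifted (α : TwZ h) {x y : α.ι} {k l : ℤ} (hx : α.obj x = .shifted k)
    (hy : α.obj y = .shifted l) : α.Q y x = 0 := by
  have := α.Q_mem y x
  rw [hx, hy] at this
  exact AHom_eq_zero_of_parity (by decide) this

theorem Q_plain_shifted_mem (α : TwZ h) {x y : α.ι} {k l : ℤ} (hx : α.obj x = .plain k)
    (hy : α.obj y = .shifted l) : α.Q y x ∈ AHom h (2 * (l - k) / h) 0 := by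
  have := α.Q_mem y x
  rw [hx, hy] at this
  simp only [BarHom] at this
  convert this using 2
  · ring
  · decide

/-- A diagonal entry of `Q²` is `x^h ≠ 0`, so some product `Q x y * Q y x` is nonzero. The indices
`x` and `y` have opposite parity, and one of the two factors goes from even to odd. -/
theorem exists_plain_shifted_ne_zero (α : TwZ h) [Nonempty α.ι] :
    ∃ a b, (∃ k, α.obj a = .plain k) ∧ (∃ l, α.obj b = .shifted l) ∧ α.Q b a ≠ 0 := by
  obtain ⟨x⟩ := ‹Nonempty α.ι›
  have h1 : (α.Q * α.Q) x x ≠ 0 := by simp [α.Q_mul_Q]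
  rw [Matrix.mul_apply] at h1
  obtain ⟨y, -, hy⟩ := Finset.exists_ne_zero_of_sum_ne_zero h1
  have h2 := left_ne_zero_of_mul hy
  have h3 := right_ne_zero_of_mul hy
  rcases ex : α.obj x with k | k <;> rcases ey : α.obj y with l | l
  · exact absurd (Q_plain_plain α ex ey) h3
  · exact ⟨x, y, ⟨k, ex⟩, ⟨l, ey⟩, h3⟩
  · exact ⟨y, x, ⟨l, ey⟩, ⟨k, ex⟩, h2⟩
  · exact absurd (Q_shifted_shifted α ex ey) h3

open Classical in
/-- A nonzero entry of minimal degree of the component of `Q` from the even to the odd part. -/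
theorem exists_pivot (α : TwZ h) [Nonempty α.ι] :
    ∃ a b, (∃ k, α.obj a = .plain k) ∧ (∃ l, α.obj b = .shifted l) ∧ α.Q b a ≠ 0 ∧
      ∀ a' b', (∃ k, α.obj a' = .plain k) → (∃ l, α.obj b' = .shifted l) → α.Q b' a' ≠ 0 →
        (α.Q b a).natDegree ≤ (α.Q b' a').natDegree := by
  obtain ⟨a₀, b₀, h₀⟩ := exists_plain_shifted_ne_zero α
  obtain ⟨⟨a, b⟩, hab, hmin⟩ := Finset.exists_min_image
    (Finset.univ.filter fun x : α.ι × α.ι =>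
      (∃ k, α.obj x.1 = .plain k) ∧ (∃ l, α.obj x.2 = .shifted l) ∧ α.Q x.2 x.1 ≠ 0)
    (fun x => (α.Q x.2 x.1).natDegree) ⟨(a₀, b₀), by simpa using h₀⟩
  simp only [Finset.mem_filter, Finset.mem_univ, true_and] at hab hmin
  exact ⟨a, b, hab.1, hab.2.1, hab.2.2, fun a' b' h1 h2 h3 => hmin (a', b') ⟨h1, h2, h3⟩⟩

theorem diagonal_C_mem_TwHom (α : TwZ h) (c : α.ι → ℂ) :
    Matrix.diagonal (fun x => C (c x)) ∈ TwHom 0 α α := by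
  intro y x
  by_cases e : y = x
  · subst e
    rw [Matrix.diagonal_apply_eq]
    cases α.obj y <;> simpa [BarHom] using C_mem_AHom (c y)
  · rw [Matrix.diagonal_apply_ne _ e]
    exact Submodule.zero_mem _

/-! ### Gaussian elimination and splitting off a rank two summand. -/

/-- The elementary operations which clear the row and the column of a pivot. -/
theorem exists_iso_cleared (h0 : h ≠ 0) (α : DbZ h) {a b : α.ι} {k l : ℤ}
    (ha : α.obj a = .plain k) (hb : α.obj b = .shifted l) (hab : α.Q b a ≠ 0)
    (hmin : ∀ a' b', (∃ k, α.obj a' = .plain k) → (∃ l, α.obj b' = .shifted l) →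
      α.Q b' a' ≠ 0 → (α.Q b a).natDegree ≤ (α.Q b' a').natDegree) :
    ∃ Q' : Matrix α.ι α.ι ℂ[X], ∃ Q_mem mc,
      Nonempty (α ≅ (⟨α.ι, α.obj, Q', Q_mem, mc⟩ : DbZ h)) ∧ Q' b a = α.Q b a ∧
        (∀ x, x ≠ b → Q' x a = 0) ∧ (∀ x, x ≠ a → Q' b x = 0) := by
  have hba := Q_plain_shifted_mem α ha hb
  have hr : ∀ x, ∃ r ∈ BarHom h 0 0 (α.obj b) (α.obj x),
      (x ≠ b → α.Q x a = r * α.Q b a) ∧ (x = b → r = 0) ∧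
        ∀ k, α.obj x = .plain k → r = 0 := by
    intro x
    by_cases hx : x = b
    · exact ⟨0, Submodule.zero_mem _, by simp [hx]⟩
    rcases ex : α.obj x with m | m
    · exact ⟨0, Submodule.zero_mem _, by simp [Q_plain_plain α ha ex], by simp⟩
    · obtain ⟨r, hr, e⟩ := exists_mul_eq_of_mem_AHom h0 (Q_plain_shifted_mem α ha ex) hba hab
        (hmin a x ⟨k, ha⟩ ⟨m, ex⟩)
      refine ⟨r, ?_, fun _ => e, fun h1 => absurd h1 hx, by simp⟩
      rw [hb]
      simp only [BarHom]
      convert hr using 2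
      ring
  have hs : ∀ x, ∃ s ∈ BarHom h 0 0 (α.obj x) (α.obj a),
      (x ≠ a → α.Q b x = s * α.Q b a) ∧ (x = a → s = 0) ∧
        ∀ k, α.obj x = .shifted k → s = 0 := by
    intro x
    by_cases hx : x = a
    · exact ⟨0, Submodule.zero_mem _, by simp [hx]⟩
    rcases ex : α.obj x with m | m
    · obtain ⟨r, hr, e⟩ := exists_mul_eq_of_mem_AHom h0 (Q_plain_shifted_mem α ex hb) hba hab
        (hmin x b ⟨m, ex⟩ ⟨l, hb⟩)
      refine ⟨r, ?_, fun _ => e, fun h1 => absurd h1 hx, by simp⟩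
      rw [ha]
      simp only [BarHom]
      convert hr using 2
      ring
    · exact ⟨0, Submodule.zero_mem _, by simp [Q_shifted_shifted α ex hb], by simp⟩
  choose r hr hr1 hr2 hr3 using hr
  choose s hs hs1 hs2 hs3 using hs
  -- Here `r` is supported on odd indices other than `b`, and `s` on even indices other than `a`.
  -- Hence `N² = 0`, and `1 + N` performs all row and column operations at once with inverse `1 -
  -- N`.
  let N : Matrix α.ι α.ι ℂ[X] :=
    Matrix.vecMulVec (Pi.single a 1) s - Matrix.vecMulVec r (Pi.single b 1)
  have hrs : s ⬝ᵥ r = 0 := Finset.sum_eq_zero fun x _ => by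
    rcases ex : α.obj x with m | m
    · simp [hr3 x m ex]
    · simp [hs3 x m ex]
  have hsQ : s ⬝ᵥ (fun x => α.Q x a) = 0 := Finset.sum_eq_zero fun x _ => by
    rcases ex : α.obj x with m | m
    · simp [Q_plain_plain α ha ex]
    · simp [hs3 x m ex]
  have hQr : (fun x => α.Q b x) ⬝ᵥ r = 0 := Finset.sum_eq_zero fun x _ => by
    rcases ex : α.obj x with m | m
    · simp [hr3 x m ex]
    · simp [Q_shifted_shifted α ex hb]
  have hne : a ≠ b := by
    rintro rfl
    rw [ha] at hb
    cases hb
  have hNN : N * N = 0 := by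
    simp only [N, Matrix.sub_mul, Matrix.mul_sub, Matrix.vecMulVec_mul_vecMulVec, hrs]
    simp [hs2, hr2, hne]
  have hN : N ∈ TwHom 0 α α := by
    intro y x
    have e1 : Matrix.vecMulVec (Pi.single a 1) s y x ∈
        BarHom h ((0 : ℤ) : ℚ) ((0 : ℤ) : ZMod 2) (α.obj x) (α.obj y) := by
      by_cases e : y = a
      · subst e
        simpa [Matrix.vecMulVec_apply] using hs x
      · simp [Matrix.vecMulVec_apply, e]
    have e2 : Matrix.vecMulVec r (Pi.single b 1) y x ∈
        BarHom h ((0 : ℤ) : ℚ) ((0 : ℤ) : ZMod 2) (α.obj x) (α.obj y) := by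
      by_cases e : x = b
      · subst e
        simpa [Matrix.vecMulVec_apply] using hr y
      · simp [Matrix.vecMulVec_apply, e]
    exact Submodule.sub_mem _ e1 e2
  have one := (mem_cocycles_zero.mp (one_mem_cocycles α)).1
  have hPP' : (1 - N) * (1 + N) = 1 := by
    rw [Matrix.sub_mul, Matrix.mul_add, Matrix.mul_add, hNN]
    simp
  have I := conjIso α (1 + N) (1 - N) (Submodule.add_mem _ one hN) (Submodule.sub_mem _ one hN)
    hPP'
  -- Column `a` of `N` is zero, so the right factor leaves column `a` unchanged; dually, row `b` of
  -- `N` is zero in `hrow`.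
  have hcol : ∀ x, ((1 + N) * α.Q * (1 - N)) x a = α.Q x a - r x * α.Q b a := by
    intro x
    have h1 : ∀ y, N y a = 0 := fun y => by
      simp [N, Matrix.vecMulVec_apply, hs2, hne]
    have h2 : (N * α.Q) x a = -(r x * α.Q b a) := by
      simp only [N, Matrix.sub_mul, Matrix.vecMulVec_mul, Matrix.sub_apply,
        Matrix.vecMulVec_apply, Matrix.single_one_vecMul]
      rw [show (Matrix.vecMul s α.Q) a = 0 from hsQ]
      simp
    rw [Matrix.mul_sub, Matrix.mul_one, Matrix.sub_apply, Matrix.mul_apply (M := _ * _)]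
    simp only [h1, mul_zero, Finset.sum_const_zero, sub_zero]
    rw [Matrix.add_mul, Matrix.one_mul, Matrix.add_apply, h2, sub_eq_add_neg]
  have hrow : ∀ x, ((1 + N) * α.Q * (1 - N)) b x = α.Q b x - α.Q b a * s x := by
    intro x
    have h1 : ∀ y, N b y = 0 := fun y => by
      simp [N, Matrix.vecMulVec_apply, hr2, hne.symm]
    have h2 : (α.Q * N) b x = α.Q b a * s x := by
      simp only [N, Matrix.mul_sub, Matrix.mul_vecMulVec, Matrix.sub_apply,
        Matrix.vecMulVec_apply, Matrix.mulVec_single_one]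
      rw [show (Matrix.mulVec α.Q r) b = 0 from hQr]
      simp
    rw [Matrix.mul_assoc, Matrix.add_mul, Matrix.one_mul, Matrix.add_apply,
      Matrix.mul_apply (M := N)]
    simp only [h1, zero_mul, Finset.sum_const_zero, add_zero]
    rw [Matrix.mul_sub, Matrix.mul_one, Matrix.sub_apply, h2]
  refine ⟨(1 + N) * α.Q * (1 - N), _, _, ⟨I⟩, ?_, fun x hx => ?_, fun x hx => ?_⟩
  · simp [hcol, hr2]
  · rw [hcol, hr1 x hx, sub_self]
  · rw [hrow, hs1 x hx, mul_comm, sub_self]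

/-- A cleared pivot splits off a summand of rank two. -/
theorem exists_iso_of_cleared_of_eq_X_pow (h0 : h ≠ 0) (α : DbZ h) {a b : α.ι} {k : ℤ} {m : ℕ}
    (ha : α.obj a = .plain k) (hb : α.obj b = .shifted (m + k)) (hab : α.Q b a = X ^ m)
    (hcol : ∀ x, x ≠ b → α.Q x a = 0) (hrow : ∀ x, x ≠ a → α.Q b x = 0) :
    ∃ (hm : m ≤ h) (β : DbZ h), Fintype.card β.ι < Fintype.card α.ι ∧
      Nonempty (α ≅ rankTwo h0 m hm k ⊞ β) := by
  have hne : a ≠ b := by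
    rintro rfl
    rw [ha] at hb
    cases hb
  have hX : (X : ℂ[X]) ^ m ≠ 0 := pow_ne_zero m X_ne_zero
  -- Row `b` of `Q² = x^h` has a single surviving term, which determines row `a` of `Q`; column `a`
  -- of the same equation determines column `b`.
  have hmul : ∀ x, α.Q b a * α.Q a x = X ^ h * (1 : Matrix α.ι α.ι ℂ[X]) b x := fun x => by
    have := congrFun (congrFun α.Q_mul_Q b) x
    rw [Matrix.mul_apply, Finset.sum_eq_single a (fun y _ hy => by rw [hrow y hy, zero_mul])
      (by simp)] at this
    simpa using this
  have hmul' : ∀ x, α.Q x b * α.Q b a = X ^ h * (1 : Matrix α.ι α.ι ℂ[X]) x a := fun x => by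
    have := congrFun (congrFun α.Q_mul_Q x) a
    rw [Matrix.mul_apply, Finset.sum_eq_single b (fun y _ hy => by rw [hcol y hy, mul_zero])
      (by simp)] at this
    simpa using this
  rw [hab] at hmul hmul'
  have hrow' : ∀ x, x ≠ b → α.Q a x = 0 := fun x hx => by
    simpa [Matrix.one_apply_ne hx.symm, hX] using hmul x
  have hcol' : ∀ x, x ≠ a → α.Q x b = 0 := fun x hx => by
    simpa [Matrix.one_apply_ne hx, hX] using hmul' x
  have hbb := hmul b
  rw [Matrix.one_apply_eq, mul_one] at hbb
  have hm : m ≤ h := by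
    have : (X : ℂ[X]) ^ m ∣ X ^ h := ⟨_, hbb.symm⟩
    exact (pow_dvd_pow_iff X_ne_zero not_isUnit_X).mp this
  have hQab : α.Q a b = X ^ (h - m) := by
    refine mul_left_cancel₀ hX ?_
    rw [hbb, ← pow_add]
    congr 1
    omega
  let β : DbZ h :=
    { ι := {x : α.ι // ¬(x = a ∨ x = b)}
      obj := fun x => α.obj x
      Q := α.Q.submatrix Subtype.val Subtype.val
      Q_mem := fun x y => α.Q_mem x y
      maurerCartan := by
        rw [sub_eq_zero]
        ext1 x y
        have := congrFun (congrFun α.Q_mul_Q x) y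
        -- The paths through `a` and `b` contribute nothing, so the complementary block squares to
        -- `x^h` by itself.
        rw [Matrix.mul_apply,
          ← Fintype.sum_subtype_add_sum_subtype (fun z => z = a ∨ z = b)] at this
        rw [Finset.sum_eq_zero, zero_add] at this
        · rw [Matrix.mul_apply]
          refine Eq.trans ?_ this.symm
          simp [Matrix.one_apply, Subtype.ext_iff]
        · rintro ⟨z, rfl | rfl⟩ -
          · rw [hrow' _ fun e => y.2 (Or.inr e), mul_zero]
          · rw [hrow _ fun e => y.2 (Or.inl e), mul_zero] }
  let e₁ : Fin 2 ≃ {x : α.ι // x = a ∨ x = b} :=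
    { toFun := ![⟨a, Or.inl rfl⟩, ⟨b, Or.inr rfl⟩]
      invFun := fun x => if x.1 = a then 0 else 1
      left_inv := fun x => by fin_cases x <;> simp [hne.symm]
      right_inv := by rintro ⟨x, rfl | rfl⟩ <;> simp [hne.symm] }
  let e : Fin 2 ⊕ {x : α.ι // ¬(x = a ∨ x = b)} ≃ α.ι :=
    (e₁.sumCongr (Equiv.refl _)).trans (Equiv.sumCompl fun x => x = a ∨ x = b)
  refine ⟨hm, β, ?_, ?_⟩
  · have := Fintype.card_congr e
    rw [Fintype.card_sum, Fintype.card_fin] at this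
    change Fintype.card {x : α.ι // ¬(x = a ∨ x = b)} < _
    omega
  · obtain ⟨I⟩ : Nonempty (α ≅ dirSum (rankTwo h0 m hm k) β) := by
      refine nonempty_iso_of_equiv e ?_ ?_
      · rintro (x | x)
        · fin_cases x
          · exact ha
          · exact hb
        · rfl
      · have z : α.Q a a = 0 := hrow' a hne
        have z' : α.Q b b = 0 := hrow b hne.symm
        rintro (x | x) (y | y)
        · fin_cases x <;> fin_cases y
          · exact z
          · exact hQab
          · exact hab
          · exact z'
        · fin_cases x
          · exact hrow' y fun e => y.2 (Or.inr e)
          · exact hrow y fun e => y.2 (Or.inl e)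
        · fin_cases y
          · exact hcol x fun e => x.2 (Or.inr e)
          · exact hcol' x fun e => x.2 (Or.inl e)
        · rfl
    exact ⟨I ≪≫ dirSumIso _ _⟩

theorem exists_iso_of_cleared (h0 : h ≠ 0) (α : DbZ h) {a b : α.ι} {k l : ℤ}
    (ha : α.obj a = .plain k) (hb : α.obj b = .shifted l) (hab : α.Q b a ≠ 0)
    (hcol : ∀ x, x ≠ b → α.Q x a = 0) (hrow : ∀ x, x ≠ a → α.Q b x = 0) :
    ∃ (m : ℕ) (hm : m ≤ h) (i : ℤ) (β : DbZ h),
      Fintype.card β.ι < Fintype.card α.ι ∧ Nonempty (α ≅ rankTwo h0 m hm i ⊞ β) := by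
  obtain ⟨-, m, c, hc, hm, e⟩ :=
    exists_eq_monomial_of_mem_AHom h0 (Q_plain_shifted_mem α ha hb) hab
  have hl : l = m + k := by
    have : (h : ℚ) ≠ 0 := by exact_mod_cast h0
    field_simp at hm
    have : (m : ℚ) = l - k := by linarith
    have : (m : ℤ) = l - k := by exact_mod_cast this
    omega
  have hne : a ≠ b := by
    rintro rfl
    rw [ha] at hb
    cases hb
  -- Rescaling the basis vector `b` turns the pivot `c x^m` into `x^m` and keeps the cleared entries
  -- zero.
  let t : α.ι → ℂ := fun x => if x = b then c⁻¹ else 1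
  let t' : α.ι → ℂ := fun x => if x = b then c else 1
  have ht : Matrix.diagonal (fun x => C (t' x)) * Matrix.diagonal (fun x => C (t x)) = 1 := by
    rw [Matrix.diagonal_mul_diagonal, ← Matrix.diagonal_one]
    congr 1
    ext1 x
    by_cases hx : x = b <;> simp [t, t', hx, ← C_mul, hc]
  have hQ : ∀ x y, (Matrix.diagonal (fun x => C (t x)) * α.Q *
      Matrix.diagonal (fun x => C (t' x))) x y = C (t x) * α.Q x y * C (t' y) := fun x y => by
    rw [Matrix.mul_diagonal, Matrix.diagonal_mul]
  have I := conjIso α _ _ (diagonal_C_mem_TwHom α t) (diagonal_C_mem_TwHom α t') ht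
  obtain ⟨hm, β, hβ, ⟨J⟩⟩ := exists_iso_of_cleared_of_eq_X_pow h0
    (conj α _ _ (diagonal_C_mem_TwHom α t) (diagonal_C_mem_TwHom α t') ht) (a := a) (b := b)
    ha (hl ▸ hb) (m := m) ((hQ b a).trans (by
      rw [e]
      simp only [t, t', hne, if_true, if_false, C_1, mul_one]
      rw [← mul_assoc, ← C_mul, inv_mul_cancel₀ hc, C_1, one_mul]))
    (fun x hx => (hQ x a).trans (by rw [hcol x hx]; simp))
    (fun x hx => (hQ b x).trans (by rw [hrow x hx]; simp))
  exact ⟨m, hm, k, β, hβ, ⟨I ≪≫ J⟩⟩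

theorem exists_iso_rankTwo_biprod (h0 : h ≠ 0) (α : DbZ h) [Nonempty α.ι] :
    ∃ (m : ℕ) (hm : m ≤ h) (i : ℤ) (β : DbZ h),
      Fintype.card β.ι < Fintype.card α.ι ∧ Nonempty (α ≅ rankTwo h0 m hm i ⊞ β) := by
  obtain ⟨a, b, ⟨k, ha⟩, ⟨l, hb⟩, hab, hmin⟩ := exists_pivot α
  obtain ⟨Q', Q_mem, mc, ⟨I⟩, hba, hcol, hrow⟩ := exists_iso_cleared h0 α ha hb hab hmin
  obtain ⟨m, hm, i, β, hβ, ⟨J⟩⟩ := exists_iso_of_cleared h0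
    (⟨α.ι, α.obj, Q', Q_mem, mc⟩ : DbZ h) ha hb (hba.trans_ne hab) hcol hrow
  exact ⟨m, hm, i, β, hβ, ⟨I ≪≫ J⟩⟩

/-! ### Classification by induction on the number of formal summands. -/

theorem exists_iso_M_of_indecomposable (h0 : h ≠ 0) (n : ℕ) (α : DbZ h)
    (hn : Fintype.card α.ι = n) (hα : Indecomposable α) :
    ∃ (l : Set.Icc 1 (h - 1)) (i : ℤ), Nonempty (α ≅ M h l i) := by
  induction n using Nat.strong_induction_on generalizing α with
  | _ n ih =>
    subst hn
    have hne : Nonempty α.ι := by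
      by_contra he
      rw [not_nonempty_iff] at he
      refine hα.1 ((IsZero.iff_id_eq_zero _).mpr ?_)
      rw [← toHom_one, ← toHom_zero]
      exact toHom_congr (Subsingleton.elim _ _) _
    obtain ⟨m, hm, i, β, hβ, ⟨e⟩⟩ := exists_iso_rankTwo_biprod h0 α
    by_cases hm' : m = 0 ∨ m = h
    · have hz := isZero_rankTwo h0 m hm i hm'
      -- A contractible summand can be dropped, leaving a smaller isomorphic representative.
      have e' : α ≅ β := e ≪≫ (isoZeroBiprod hz).symm
      obtain ⟨l, j, ⟨e''⟩⟩ := ih _ hβ β rfl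
        ⟨fun hz => hα.1 (hz.of_iso e'), fun Y Z I => hα.2 Y Z (e' ≪≫ I)⟩
      exact ⟨l, j, ⟨e' ≪≫ e''⟩⟩
    · rw [not_or] at hm'
      refine ⟨⟨m, by omega, by omega⟩, i, ?_⟩
      -- For `0 < m < h` the split summand is by definition an `M`, hence nonzero, so the complement
      -- must vanish.
      rcases hα.2 _ _ e with hz | hz
      · exact absurd hz (not_isZero_M ⟨m, by omega, by omega⟩ i)
      · exact ⟨e ≪≫ (isoBiprodZero hz).symm⟩

end MatFac

end

theorem mainTheorem3 (h : ℕ) (hh : 2 ≤ h) :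
    (∀ α : MatFac.DbZ h, Indecomposable α ↔
      ∃ (l : Set.Icc 1 (h - 1)) (i : ℤ), Nonempty (α ≅ MatFac.M h l i)) ∧
    (∀ (k l : Set.Icc 1 (h - 1)) (i j : ℤ),
      Nonempty (MatFac.M h k i ≅ MatFac.M h l j) → k = l ∧ i = j) ∧
    (∀ (l l' : Set.Icc 1 (h - 1)) (i : ℤ), (l' : ℕ) = l + 1 →
      (!![1, 0; 0, X] : Matrix (Fin 2) (Fin 2) ℂ[X]) ∈
        MatFac.cocycles 0 (MatFac.M h l i) (MatFac.M h l' i)) ∧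
    (∀ (l l' : Set.Icc 1 (h - 1)) (i : ℤ), (l' : ℕ) + 1 = l →
      (!![X, 0; 0, 1] : Matrix (Fin 2) (Fin 2) ℂ[X]) ∈
        MatFac.cocycles 0 (MatFac.M h l i) (MatFac.M h l' (i + 1))) ∧
    (∀ (k l : Set.Icc 1 (h - 1)) (i j : ℤ),
      Nontrivial (MatFac.M h k i ⟶ MatFac.M h l j) → (k : ℤ) + 2 * i ≤ l + 2 * j) ∧
    (∀ k l : Set.Icc 1 (h - 1),
      (k ≤ l → Nonempty ((MatFac.M h k 0 ⟶ MatFac.M h l 0) ≃ₗ[ℂ] ℂ)) ∧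
      (l < k → Subsingleton (MatFac.M h k 0 ⟶ MatFac.M h l 0))) := by
  refine ⟨fun α => ⟨fun hα => MatFac.exists_iso_M_of_indecomposable (by omega) _ α rfl hα, ?_⟩,
    fun k l i j ⟨e⟩ => MatFac.eq_of_iso_M e, fun l l' i e => ?_, fun l l' i e => ?_,
    fun k l i j H => ?_, fun k l => ⟨fun hkl => MatFac.nonempty_hom_M_equiv hkl 0, fun hlk => ?_⟩⟩
  · rintro ⟨l, i, ⟨e⟩⟩
    exact MatFac.indecomposable_of_iso_M e
  · simpa using MatFac.diag_mem_cocycles l l' i i 0 1 (by simp) (by omega)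
  · simpa using MatFac.diag_mem_cocycles l l' i (i + 1) 1 0 (by simp) (by omega)
  -- The required inequality is the sum of `i ≤ j` and `k + i ≤ l + j`.
  · have := MatFac.le_of_nontrivial_hom H
    omega
  · rw [← not_nontrivial_iff_subsingleton]
    intro H
    have h1 := MatFac.le_of_nontrivial_hom H
    have h2 : (l : ℕ) < k := hlk
    omega
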